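/- Let $n\ge 1$ and let $m,k,l$ be integers with $0\le m,k,l\le n$, $l\le k$, $l\le m$ and $n-m-k+l\ge 0$. Let $\mathbb{C}^2=\mathbb{C}|0\rangle\oplus\mathbb{C}|1\rangle$, and equip $(\mathbb{C}^2)^{\otimes n}$ with its standard Hermitian form and with the action $g\mapsto g^{\otimes n}$ of $\mathrm{SU}(2)$. Consider the unit vector $$|\Xi_{n,m|k,l}\rangle:=|1\rangle^{\otimes l}\otimes|0\rangle^{\otimes(k-l)}\otimes\binom{n-k}{m-l}^{-1/2}\sum_{I\in\{0,1\}^{n-k},\ |I|=m-l}|I\rangle\ \in(\mathbb{C}^2)^{\otimes n},$$ where $|I|$ is the number of ones in $I$. For $0\le x\le\lfloor n/2\rfloor$ let $\mathsf{P}_{(n-x,x)}$ be the orthogonal projector of $(\mathbb{C}^2)^{\otimes n}$ onto the isotypical component of the irreducible $\mathrm{SU}(2)$-representation of dimension $n-2x+1$, and put $$p(x):=\langle\Xi_{n,m|k,l}|\,\mathsf{P}_{(n-x,x)}\,|\Xi_{n,m|k,l}\rangle .$$ Then $p$ is a probability mass function on $\{0,1,\dots,\lfloor n/2\rfloor\}$,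 and if $X$ is a random variable distributed by $p$, then its expectation and variance are related by $$\frac{\mathrm{Var}[X]}{n^2}=\frac{\mathbb{E}[X]}{n}\Bigl(1-\frac{\mathbb{E}[X]}{n}\Bigr)+\frac{\mathbb{E}[X]}{n^2}-\eta,\qquad \eta:=\frac{m(n-m)-(m-l)(n-m-k+l)}{n^2}.$$ -/

import Mathlib

open scoped ENNReal

noncomputable section

namespace SchurWeyl

/-- The `n`-qubit space `(ℂ²)^{⊗ n}` with its standard Hermitian form, given by its orthonormal
basis `|i₁ ⋯ iₙ⟩`, `i_r ∈ {0, 1}`: a vector is the family of its coordinates. -/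
abbrev Qubits (n : ℕ) : Type := EuclideanSpace ℂ (Fin n → Fin 2)

/-- The basis vector `|I⟩ = |i₁ ⋯ iₙ⟩`. -/
def ket {n : ℕ} (I : Fin n → Fin 2) : Qubits n := EuclideanSpace.single I 1

/-- The tensor product `v ⊗ w ∈ (ℂ²)^{⊗ n}` of `v ∈ (ℂ²)^{⊗ a}` (the first `a` factors) and
`w ∈ (ℂ²)^{⊗ b}` (the last `b` factors), where `a + b = n`. -/
def tensor {a b n : ℕ} (h : a + b = n) (v : Qubits a) (w : Qubits b) : Qubits n :=
  WithLp.toLp 2 fun I =>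
    v (fun i => I (Fin.cast h (Fin.castAdd b i))) * w (fun j => I (Fin.cast h (Fin.natAdd a j)))

/-- The vector `|1^l 0^{k-l}⟩ ∈ (ℂ²)^{⊗ k}`. -/
def onesZeros (k l : ℕ) : Qubits k := ket fun i => if (i : ℕ) < l then 1 else 0

/-- The Dicke state `|Ξ_{n,m}⟩ = (n choose m)^{-1/2} ∑_{|I| = m} |I⟩ ∈ (ℂ²)^{⊗ n}`, the sum over
all basis vectors with exactly `m` ones. -/
def dicke (n m : ℕ) : Qubits n :=
  (((Real.sqrt (n.choose m : ℝ))⁻¹ : ℝ) : ℂ) •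
    ∑ I : Fin n → Fin 2 with (Finset.univ.filter fun i => I i = 1).card = m, ket I

/-- The vector `|Ξ_{n,m|k,l}⟩ = |1^l 0^{k-l}⟩ ⊗ |Ξ_{n-k,m-l}⟩ ∈ (ℂ²)^{⊗ n}`. -/
def xi (n m k l : ℕ) (hk : k ≤ n) : Qubits n :=
  tensor (Nat.add_sub_of_le hk) (onesZeros k l) (dicke (n - k) (m - l))

/-- The matrix of `A^{⊗ n}` in the basis `|I⟩`. -/
def tensorPowMatrix (n : ℕ) (A : Matrix (Fin 2) (Fin 2) ℂ) :
    Matrix (Fin n → Fin 2) (Fin n → Fin 2) ℂ :=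
  Matrix.of fun I J => ∏ r, A (I r) (J r)

theorem tensorPowMatrix_one (n : ℕ) : tensorPowMatrix n 1 = 1 := by
  ext I J
  simp only [tensorPowMatrix, Matrix.of_apply, Matrix.one_apply, Finset.prod_ite_zero,
    Finset.mem_univ, true_implies, Finset.prod_const_one, funext_iff]

theorem tensorPowMatrix_mul (n : ℕ) (A B : Matrix (Fin 2) (Fin 2) ℂ) :
    tensorPowMatrix n (A * B) = tensorPowMatrix n A * tensorPowMatrix n B := by
  ext I J
  simp only [tensorPowMatrix, Matrix.of_apply, Matrix.mul_apply, ← Finset.prod_mul_distrib]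
  rw [Finset.prod_univ_sum, Fintype.piFinset_univ]

/-- The special unitary group `SU(2)`. -/
abbrev SU2 : Type := Matrix.specialUnitaryGroup (Fin 2) ℂ

/-- The representation `g ↦ g^{⊗ n}` of `SU(2)` on `(ℂ²)^{⊗ n}`. -/
def tensorRep (n : ℕ) : Representation ℂ SU2 (Qubits n) where
  toFun g := Matrix.toLpLin 2 2 (tensorPowMatrix n (g : Matrix (Fin 2) (Fin 2) ℂ))
  map_one' := by
    rw [OneMemClass.coe_one, tensorPowMatrix_one, Matrix.toLpLin_one]; rfl
  map_mul' g h := by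
    rw [Submonoid.coe_mul, tensorPowMatrix_mul, Matrix.toLpLin_mul 2 2 2]; rfl

/-- The isotypical component `𝒰_{(n-x,x)} ⊠ 𝒱_{(n-x,x)}` of `(ℂ²)^{⊗ n}`, where `𝒰_{(n-x,x)}` is
the irreducible representation of `SU(2)` of dimension `n - 2x + 1`: the sum of all irreducible
subrepresentations of that dimension (irreducible representations of `SU(2)` of equal dimension
are equivalent).  Meaningful for `2x ≤ n`. -/
def isotypic (n x : ℕ) : Submodule ℂ (Qubits n) :=
  ⨆ W ∈ {W : Subrepresentation (tensorRep n) |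
      W.toRepresentation.IsIrreducible ∧ Module.finrank ℂ W.toSubmodule = n - 2 * x + 1},
    W.toSubmodule

/-- `p(x | n,m,k,l) = ⟨Ξ_{n,m|k,l}| P_{(n-x,x)} |Ξ_{n,m|k,l}⟩` with `P_{(n-x,x)}` the orthogonal
projector onto the isotypical component (a real number, as `P_{(n-x,x)}` is self-adjoint). -/
def pmf (n m k l : ℕ) (hk : k ≤ n) (x : ℕ) : ℝ :=
  (inner ℂ (xi n m k l hk) ((isotypic n x).starProjection (xi n m k l hk))).re

/-- The distribution `P_{n,m,k,l}` on `{0, 1, …, ⌊n/2⌋}` with mass `p(x | n,m,k,l)` at `x`. -/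
def law (n m k l : ℕ) (hk : k ≤ n) : MeasureTheory.Measure ℕ :=
  ∑ x ∈ Finset.range (n / 2 + 1), ENNReal.ofReal (pmf n m k l hk x) • MeasureTheory.Measure.dirac x

/-- `η = (m(n-m) - (m-l)(n-m-k+l)) / n²`, computed in `ℝ`. -/
def eta (n m k l : ℝ) : ℝ := (m * (n - m) - (m - l) * (n - m - k + l)) / n ^ 2

end SchurWeyl

end

noncomputable section

namespace SchurWeyl

open Finset MeasureTheory

variable {n : ℕ}

/-! Let `N`, `E`, `F` be the collective operators that count, remove and add ones. The Casimir
operator `C = (n+1)N - N² - FE` acts on the isotypical component indexed by `x` as the scalar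
`x(n+1-x)`. Hence `𝔼[X(n+1-X)] = ⟨Ξ|C|Ξ⟩`, and the right side is computed by counting strings: `N`
is `m` on `Ξ`, and `⟨Ξ|FE|Ξ⟩ = m + (m-l)(n-m-k+l)`, so the value is `n²η`. The variance formula is
this single identity rearranged with `Var X = 𝔼[X²] - 𝔼[X]²`.

The scalar is found on the Lie algebra side. `SU(2)`-stable subspaces coincide with `𝔤𝔩₂`-stable
ones (`forall_tensorRep_mem_iff`), and an irreducible one is the `F`-string of a vector killed by
`E` (`exists_collStable_weight_string`), so its dimension determines its Casimir scalar
(`casimir_of_isIrreducible`). Complete reducibility (`iSup_isotypic`) and symmetry of `C` make the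
components an orthogonal decomposition (`exists_isotypic_decomposition`). The string count is
`coll_fMat_coll_eMat_xi_apply`. -/

/-! ### Single-qubit and collective operators. -/

/-- The operator acting by the matrix `A` on the `r`-th qubit. -/
def site (r : Fin n) (A : Matrix (Fin 2) (Fin 2) ℂ) : Qubits n →ₗ[ℂ] Qubits n where
  toFun v := WithLp.toLp 2 fun I => ∑ a, A (I r) a * v (Function.update I r a)
  map_add' v w := by
    ext I
    simp only [PiLp.add_apply, mul_add, sum_add_distrib]
  map_smul' c v := by
    ext I
    simp only [PiLp.smul_apply, smul_eq_mul, RingHom.id_apply, mul_sum]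
    exact sum_congr rfl fun _ _ => by ring

theorem site_apply (r : Fin n) (A : Matrix (Fin 2) (Fin 2) ℂ) (v : Qubits n) (I : Fin n → Fin 2) :
    site r A v I = ∑ a, A (I r) a * v (Function.update I r a) := rfl

theorem site_mul_same (r : Fin n) (A B : Matrix (Fin 2) (Fin 2) ℂ) :
    site r A * site r B = site r (A * B) := by
  ext v I
  simp only [Module.End.mul_apply, site_apply, Function.update_self, Function.update_idem,
    Matrix.mul_apply, mul_sum, sum_mul]
  rw [sum_comm]
  exact sum_congr rfl fun _ _ => sum_congr rfl fun _ _ => by ring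

theorem site_commute {r s : Fin n} (h : r ≠ s) (A B : Matrix (Fin 2) (Fin 2) ℂ) :
    Commute (site r A) (site s B) := by
  refine LinearMap.ext fun v => ?_
  ext I
  simp only [Module.End.mul_apply, site_apply, mul_sum]
  rw [sum_comm]
  refine sum_congr rfl fun b _ => sum_congr rfl fun a _ => ?_
  rw [Function.update_of_ne h.symm, Function.update_of_ne h, Function.update_comm h]
  ring

theorem site_add (r : Fin n) (A B : Matrix (Fin 2) (Fin 2) ℂ) :
    site r (A + B) = site r A + site r B := by
  ext v I
  simp only [LinearMap.add_apply, PiLp.add_apply, site_apply, Matrix.add_apply, add_mul,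
    sum_add_distrib]

theorem site_smul (r : Fin n) (c : ℂ) (A : Matrix (Fin 2) (Fin 2) ℂ) :
    site r (c • A) = c • site r A := by
  ext v I
  simp only [LinearMap.smul_apply, PiLp.smul_apply, site_apply, Matrix.smul_apply, smul_eq_mul,
    mul_sum, mul_assoc]

theorem site_one (r : Fin n) : site r (1 : Matrix (Fin 2) (Fin 2) ℂ) = 1 := by
  ext v I
  simp [site_apply, Matrix.one_apply]

theorem inner_site (r : Fin n) (A : Matrix (Fin 2) (Fin 2) ℂ) (v w : Qubits n) :
    inner ℂ (site r A v) w = inner ℂ v (site r A.conjTranspose w) := by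
  simp only [PiLp.inner_apply, RCLike.inner_apply, site_apply, map_sum, mul_sum, sum_mul, map_mul,
    Matrix.conjTranspose_apply]
  rw [← sum_product', ← sum_product']
  -- Exchanging the replacement symbol `a` with `I r` is an involution of the pairs `(I, a)`; it
  -- transposes the matrix entry.
  refine sum_nbij' (fun p => (Function.update p.1 r p.2, p.1 r))
    (fun p => (Function.update p.1 r p.2, p.1 r)) (by simp) (by simp) (by simp) (by simp) ?_
  rintro ⟨I, a⟩ -
  simp only [Function.update_self, Function.update_idem, Function.update_eq_self]
  simp only [starRingEnd_apply]
  ring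

/-- The collective operator `∑ r, A_r`, the image of `A` under the derivative of `A ↦ A^{⊗ n}`. -/
def coll (n : ℕ) (A : Matrix (Fin 2) (Fin 2) ℂ) : Module.End ℂ (Qubits n) := ∑ r, site r A

theorem coll_apply (A : Matrix (Fin 2) (Fin 2) ℂ) (v : Qubits n) (I : Fin n → Fin 2) :
    coll n A v I = ∑ r, ∑ a, A (I r) a * v (Function.update I r a) := by
  simp [coll, LinearMap.sum_apply, site_apply]

theorem coll_add (A B : Matrix (Fin 2) (Fin 2) ℂ) : coll n (A + B) = coll n A + coll n B := by
  simp [coll, site_add, sum_add_distrib]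

theorem coll_smul (c : ℂ) (A : Matrix (Fin 2) (Fin 2) ℂ) : coll n (c • A) = c • coll n A := by
  simp [coll, site_smul, smul_sum]

theorem coll_one : coll n 1 = (n : ℂ) • (1 : Module.End ℂ (Qubits n)) := by
  simp [coll, site_one, Nat.cast_smul_eq_nsmul]

/-- Operators on different qubits commute, so only the diagonal terms of the double sum survive. -/
theorem coll_commutator (A B : Matrix (Fin 2) (Fin 2) ℂ) :
    coll n A * coll n B = coll n B * coll n A + coll n (A * B + (-1 : ℂ) • (B * A)) := by
  rw [coll_add, coll_smul, neg_one_smul, ← sub_eq_add_neg, ← sub_eq_iff_eq_add']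
  simp only [coll, sum_mul_sum]
  rw [sum_comm (f := fun i j => site i B * site j A), ← sum_sub_distrib, ← sum_sub_distrib]
  refine sum_congr rfl fun r _ => ?_
  rw [← sum_sub_distrib, sum_eq_single r, site_mul_same, site_mul_same]
  · intro s _ h
    rw [(site_commute h.symm A B).eq, sub_self]
  · simp

theorem inner_coll (A : Matrix (Fin 2) (Fin 2) ℂ) (v w : Qubits n) :
    inner ℂ (coll n A v) w = inner ℂ v (coll n A.conjTranspose w) := by
  simp only [coll, LinearMap.sum_apply, sum_inner, inner_sum, inner_site]

/-! ### The `𝔤𝔩₂` relations and the Casimir operator. -/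

/-- The matrix `|0⟩⟨1|`, which removes a one. -/
def eMat : Matrix (Fin 2) (Fin 2) ℂ := !![0, 1; 0, 0]

/-- The matrix `|1⟩⟨0|`, which adds a one. -/
def fMat : Matrix (Fin 2) (Fin 2) ℂ := !![0, 0; 1, 0]

/-- The matrix `|1⟩⟨1|`, which counts ones. -/
def nMat : Matrix (Fin 2) (Fin 2) ℂ := !![0, 0; 0, 1]

theorem eMat_conjTranspose : eMat.conjTranspose = fMat := by
  ext i j; fin_cases i <;> fin_cases j <;> simp [eMat, fMat]

theorem fMat_conjTranspose : fMat.conjTranspose = eMat := by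
  ext i j; fin_cases i <;> fin_cases j <;> simp [eMat, fMat]

theorem nMat_conjTranspose : nMat.conjTranspose = nMat := by
  ext i j; fin_cases i <;> fin_cases j <;> simp [nMat]

theorem matrix_eq_combination (A : Matrix (Fin 2) (Fin 2) ℂ) :
    A = A 0 0 • 1 + (A 1 1 - A 0 0) • nMat + A 0 1 • eMat + A 1 0 • fMat := by
  ext i j; fin_cases i <;> fin_cases j <;> simp [eMat, fMat, nMat]

theorem coll_e_f (v : Qubits n) : coll n eMat (coll n fMat v)
    = coll n fMat (coll n eMat v) + (n : ℂ) • v - (2 : ℂ) • coll n nMat v := by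
  have h : eMat * fMat + (-1 : ℂ) • (fMat * eMat) = 1 + (-2 : ℂ) • nMat := by
    ext i j; fin_cases i <;> fin_cases j <;> norm_num [eMat, fMat, nMat]
  have := LinearMap.congr_fun (coll_commutator (n := n) eMat fMat) v
  rw [h, coll_add, coll_one, coll_smul] at this
  simp only [Module.End.mul_apply, LinearMap.add_apply, LinearMap.smul_apply,
    Module.End.one_apply] at this
  rw [this, neg_smul]; abel

theorem coll_n_f (v : Qubits n) :
    coll n nMat (coll n fMat v) = coll n fMat (coll n nMat v) + coll n fMat v := by
  have h : nMat * fMat + (-1 : ℂ) • (fMat * nMat) = fMat := by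
    ext i j; fin_cases i <;> fin_cases j <;> simp [fMat, nMat]
  have := LinearMap.congr_fun (coll_commutator (n := n) nMat fMat) v
  rwa [h] at this

theorem coll_n_e (v : Qubits n) :
    coll n nMat (coll n eMat v) = coll n eMat (coll n nMat v) - coll n eMat v := by
  have h : nMat * eMat + (-1 : ℂ) • (eMat * nMat) = (-1 : ℂ) • eMat := by
    ext i j; fin_cases i <;> fin_cases j <;> simp [eMat, nMat]
  have := LinearMap.congr_fun (coll_commutator (n := n) nMat eMat) v
  rw [h, coll_smul] at this
  simpa [sub_eq_add_neg] using this

theorem coll_nMat_apply (v : Qubits n) (I : Fin n → Fin 2) :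
    coll n nMat v I = ((univ.filter fun i => I i = 1).card : ℂ) * v I := by
  rw [coll_apply, card_filter, Nat.cast_sum, sum_mul]
  refine sum_congr rfl fun r _ => ?_
  obtain h | h : I r = 0 ∨ I r = 1 := by lia
  · simp [nMat, h]
  · have hu : Function.update I r 1 = I := by rw [← h, Function.update_eq_self]
    simp [nMat, h, hu]

/-- The Casimir operator, normalised to be `x (n + 1 - x)` on the representation of
dimension `n - 2 x + 1`. -/
def casimir (n : ℕ) : Module.End ℂ (Qubits n) :=
  ((n : ℂ) + 1) • coll n nMat - coll n nMat * coll n nMat - coll n fMat * coll n eMat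

theorem casimir_apply (v : Qubits n) : casimir n v = ((n : ℂ) + 1) • coll n nMat v
    - coll n nMat (coll n nMat v) - coll n fMat (coll n eMat v) := rfl

/-- `N` is self-adjoint and `E`, `F` are mutually adjoint. Symmetry makes eigenspaces for distinct
scalars orthogonal. -/
theorem casimir_isSymmetric : (casimir n).IsSymmetric := by
  intro v w
  have h : (starRingEnd ℂ) ((n : ℂ) + 1) = n + 1 := by simp
  simp only [casimir_apply, inner_sub_left, inner_sub_right, inner_smul_left, inner_smul_right,
    inner_coll, nMat_conjTranspose, eMat_conjTranspose, fMat_conjTranspose, h]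

/-! ### Stability under the group and under the Lie algebra. -/

/-- A subspace is `𝔤𝔩₂`-stable if it is stable under all collective operators. -/
def CollStable (U : Submodule ℂ (Qubits n)) : Prop := ∀ A, ∀ v ∈ U, coll n A v ∈ U

theorem CollStable.of_generators {U : Submodule ℂ (Qubits n)} (hN : ∀ v ∈ U, coll n nMat v ∈ U)
    (hE : ∀ v ∈ U, coll n eMat v ∈ U) (hF : ∀ v ∈ U, coll n fMat v ∈ U) : CollStable U := by
  intro A v hv
  rw [matrix_eq_combination A]
  simp only [coll_add, coll_smul, coll_one, LinearMap.add_apply, LinearMap.smul_apply]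
  exact U.add_mem (U.add_mem (U.add_mem (U.smul_mem _ (U.smul_mem _ hv)) (U.smul_mem _ (hN v hv)))
    (U.smul_mem _ (hE v hv))) (U.smul_mem _ (hF v hv))

/-- The adjoint of a collective operator is again collective. -/
theorem CollStable.orthogonal {U : Submodule ℂ (Qubits n)} (h : CollStable U) :
    CollStable Uᗮ := by
  intro A v hv u hu
  have := hv _ (h A.conjTranspose u hu)
  rwa [inner_coll, Matrix.conjTranspose_conjTranspose] at this

/-- The operator `A^{⊗ n}` on `(ℂ²)^{⊗ n}`. -/
def tensorPow (n : ℕ) (A : Matrix (Fin 2) (Fin 2) ℂ) : Module.End ℂ (Qubits n) :=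
  Matrix.toLpLin 2 2 (tensorPowMatrix n A)

theorem tensorPow_apply (A : Matrix (Fin 2) (Fin 2) ℂ) (v : Qubits n) (I : Fin n → Fin 2) :
    tensorPow n A v I = ∑ J, (∏ r, A (I r) (J r)) * v J := by
  simp [tensorPow, Matrix.toLpLin_apply, Matrix.mulVec, dotProduct, tensorPowMatrix]

theorem tensorPow_one : tensorPow n 1 = 1 := by
  rw [tensorPow, tensorPowMatrix_one, Matrix.toLpLin_one]; rfl

theorem tensorPow_mul (A B : Matrix (Fin 2) (Fin 2) ℂ) :
    tensorPow n (A * B) = tensorPow n A * tensorPow n B := by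
  rw [tensorPow, tensorPowMatrix_mul, Matrix.toLpLin_mul 2 2 2]; rfl

/-- The Leibniz rule over the `n` factors. With the hypothesis in the form `B' = A B`, the curve of
vectors solves a linear equation governed by the collective operator of `A`. -/
theorem hasDerivAt_tensorPow {B : ℝ → Matrix (Fin 2) (Fin 2) ℂ} {A : Matrix (Fin 2) (Fin 2) ℂ}
    {t : ℝ} (hB : ∀ i j, HasDerivAt (fun s => B s i j) ((A * B t) i j) t) (v : Qubits n) :
    HasDerivAt (fun s => tensorPow n (B s) v) (coll n A (tensorPow n (B t) v)) t := by
  have key : HasDerivAt (fun s I => tensorPow n (B s) v I)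
      (fun I => coll n A (tensorPow n (B t) v) I) t := by
    rw [hasDerivAt_pi]
    intro I
    simp only [tensorPow_apply]
    have h : ∀ J ∈ (univ : Finset (Fin n → Fin 2)),
        HasDerivAt (fun s => (∏ r, B s (I r) (J r)) * v J)
          ((∑ r, (∏ s ∈ univ.erase r, B t (I s) (J s)) • (A * B t) (I r) (J r)) * v J) t :=
      fun J _ => (HasDerivAt.fun_finsetProd fun r _ => hB (I r) (J r)).mul_const _
    convert! HasDerivAt.fun_sum h using 1
    simp only [coll_apply, tensorPow_apply, mul_sum, sum_mul, smul_eq_mul, Matrix.mul_apply]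
    rw [sum_comm]
    conv_rhs => rw [sum_comm]
    rw [sum_comm]
    refine sum_congr rfl fun r _ => ?_
    rw [sum_comm]
    refine sum_congr rfl fun J _ => sum_congr rfl fun a _ => ?_
    rw [← mul_prod_erase univ _ (mem_univ r), Function.update_self,
      prod_congr rfl fun s hs => by rw [Function.update_of_ne (ne_of_mem_erase hs)]]
    ring
  have := ((PiLp.continuousLinearEquiv 2 ℝ fun _ : Fin n → Fin 2 => ℂ).symm
    : _ →L[ℝ] Qubits n).hasFDerivAt.comp_hasDerivAt t key
  exact this

/-- The derivative of a curve in a subspace lies in the subspace. -/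
theorem deriv_mem_of_forall_mem {U : Submodule ℂ (Qubits n)} {f : ℝ → Qubits n} {f' : Qubits n}
    {t : ℝ} (hf : HasDerivAt f f' t) (h : ∀ s, f s ∈ U) : f' ∈ U := by
  -- The projector onto `Uᗮ` vanishes along the curve, hence on its derivative.
  have h1 := ((Uᗮ.starProjection.restrictScalars ℝ).hasFDerivAt).comp_hasDerivAt t hf
  have h2 : (⇑(Uᗮ.starProjection.restrictScalars ℝ) ∘ f) = fun _ => 0 := by
    funext s
    simpa [sub_eq_zero, eq_comm (a := f s), Submodule.starProjection_eq_self_iff] using h s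
  rw [h2] at h1
  have h3 := h1.unique (hasDerivAt_const t 0)
  simpa [sub_eq_zero, eq_comm (a := f'), Submodule.starProjection_eq_self_iff] using h3

/-- The linear equation `y' = S y` has a global solution. -/
theorem exists_linear_ode_solution {V : Type*} [NormedAddCommGroup V] [NormedSpace ℂ V]
    [CompleteSpace V] (S : V →L[ℂ] V) (x : V) :
    ∃ z : ℝ → V, z 0 = x ∧ ∀ t, HasDerivAt z (S (z t)) t := by
  refine ⟨fun s => NormedSpace.exp ((s : ℂ) • S) x, by simp, fun s => ?_⟩
  have h1 : HasDerivAt (fun u : ℝ => NormedSpace.exp ((u : ℂ) • S))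
      (S * NormedSpace.exp ((s : ℂ) • S)) s := by
    simpa [Function.comp_def] using
      (hasDerivAt_exp_smul_const' (𝕂 := ℂ) S (s : ℂ)).scomp s (hasDerivAt_id s).ofReal_comp
  exact ((ContinuousLinearMap.apply ℂ V x).restrictScalars ℝ).hasFDerivAt.comp_hasDerivAt s h1

/-- Solutions of the linear equation `y' = T y` stay in a `T`-stable subspace. -/
theorem mem_of_linear_ode {V : Type*} [NormedAddCommGroup V] [NormedSpace ℂ V]
    [FiniteDimensional ℂ V] {U : Submodule ℂ V} {T : Module.End ℂ V}
    (hT : ∀ v ∈ U, T v ∈ U) {f : ℝ → V} (hf : ∀ t, HasDerivAt f (T (f t)) t)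
    (h0 : f 0 ∈ U) (t : ℝ) : f t ∈ U := by
  have : CompleteSpace U := FiniteDimensional.complete ℂ U
  -- Solve the equation inside `U`; uniqueness in `V` identifies this solution with `f`.
  obtain ⟨z, hz0, hz⟩ := exists_linear_ode_solution
    (LinearMap.toContinuousLinearMap (T.restrict hT) : U →L[ℂ] U) ⟨f 0, h0⟩
  have hz' : ∀ s, HasDerivAt (fun s => (z s : V)) (T (z s)) s := fun s =>
    ((U.subtypeL.restrictScalars ℝ).hasFDerivAt).comp_hasDerivAt s (hz s)
  let T' : V →L[ℂ] V := LinearMap.toContinuousLinearMap T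
  have : f = fun s => (z s : V) :=
    ODE_solution_unique_univ (v := fun _ x => T x) (s := fun _ => Set.univ) (K := ‖T'‖₊) (t₀ := 0)
      (fun _ => (T'.lipschitz).lipschitzOnWith) (fun t => ⟨hf t, trivial⟩)
      (fun t => ⟨hz' t, trivial⟩) (by simp [hz0])
  rw [this]
  exact (z t).2

/-- Invertible matrices are products of diagonal ones and transvections. Each such factor is reached
from the identity by a curve with `B' = A B`, so the linear equation keeps vectors in `U`. -/
theorem CollStable.tensorPow_mem {U : Submodule ℂ (Qubits n)} (hU : CollStable U)
    {M : Matrix (Fin 2) (Fin 2) ℂ} (hM : M.det ≠ 0) : ∀ v ∈ U, tensorPow n M v ∈ U := by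
  refine Matrix.diagonal_transvection_induction_of_det_ne_zero
    (fun M => ∀ v ∈ U, tensorPow n M v ∈ U) M hM ?_ ?_ ?_
  · intro D hD v hv
    rw [Matrix.det_diagonal, prod_ne_zero_iff] at hD
    let B : ℝ → Matrix (Fin 2) (Fin 2) ℂ := fun t =>
      Matrix.diagonal fun i => Complex.exp ((t : ℂ) * Complex.log (D i))
    have hB : ∀ t i j, HasDerivAt (fun s => B s i j)
        ((Matrix.diagonal (fun i => Complex.log (D i)) * B t) i j) t := by
      intro t i j
      rw [Matrix.diagonal_mul_diagonal]
      by_cases hij : i = j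
      · subst hij
        simp only [B, Matrix.diagonal_apply_eq]
        have := (((hasDerivAt_id (t : ℂ)).mul_const (Complex.log (D i))).cexp).comp_ofReal
        simpa [mul_comm] using this
      · simpa [B, Matrix.diagonal_apply_ne _ hij] using hasDerivAt_const t (0 : ℂ)
    have h := mem_of_linear_ode (hU _) (fun t => hasDerivAt_tensorPow (hB t) v)
      (by simpa [B, tensorPow_one] using hv) 1
    have h1 : B 1 = Matrix.diagonal D := by
      simp only [B, Complex.ofReal_one, one_mul]
      congr 1
      funext i
      exact Complex.exp_log (hD i (mem_univ i))
    rwa [h1] at h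
  · rintro ⟨i, j, hij, c⟩ v hv
    let B : ℝ → Matrix (Fin 2) (Fin 2) ℂ := fun t => Matrix.transvection i j ((t : ℂ) * c)
    have hB : ∀ t k l, HasDerivAt (fun s => B s k l)
        ((Matrix.single i j c * B t) k l) t := by
      intro t k l
      -- Since `i ≠ j`, the elementary matrix squares to zero.
      have h1 : Matrix.single i j c * B t = Matrix.single i j c := by
        simp [B, Matrix.transvection, mul_add, hij.symm]
      have h2 : (fun s : ℝ => B s k l)
          = fun s : ℝ => (1 : Matrix (Fin 2) (Fin 2) ℂ) k l + (s : ℂ) * Matrix.single i j c k l := by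
        funext s
        simp [B, Matrix.transvection, Matrix.single_apply]
      rw [h1, h2]
      have := (((hasDerivAt_id (t : ℂ)).mul_const (Matrix.single i j c k l)).const_add
        ((1 : Matrix (Fin 2) (Fin 2) ℂ) k l)).comp_ofReal
      simpa using this
    have h := mem_of_linear_ode (hU _) (fun t => hasDerivAt_tensorPow (hB t) v)
      (by simpa [B, tensorPow_one] using hv) 1
    simpa [B] using h
  · intro A B _ _ hA hB v hv
    rw [tensorPow_mul]
    exact hA _ (hB v hv)

theorem coll_mem_of_curve {U : Submodule ℂ (Qubits n)}
    (hU : ∀ g : SU2, ∀ v ∈ U, tensorRep n g v ∈ U) (B : ℝ → SU2)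
    {A : Matrix (Fin 2) (Fin 2) ℂ} (h0 : B 0 = 1)
    (hB : ∀ i j, HasDerivAt (fun s => (B s : Matrix (Fin 2) (Fin 2) ℂ) i j) (A i j) 0) :
    ∀ v ∈ U, coll n A v ∈ U := by
  intro v hv
  have h := hasDerivAt_tensorPow (n := n) (B := fun s => (B s : Matrix (Fin 2) (Fin 2) ℂ))
    (A := A) (t := 0) (by simpa [h0] using hB) v
  have h1 := deriv_mem_of_forall_mem h fun s => hU (B s) v hv
  simpa [h0, tensorPow_one] using h1

/-- The matrix of `SU(2)` with first row `(a, -b̄)`. -/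
def su2Mk (a b : ℂ) (h : a * star a + b * star b = 1) : SU2 :=
  ⟨!![a, -star b; b, star a], by
    rw [Matrix.mem_specialUnitaryGroup_iff, Matrix.mem_unitaryGroup_iff]
    constructor
    · ext i j
      fin_cases i <;> fin_cases j <;>
        simp [Matrix.mul_apply, Matrix.star_eq_conjTranspose] <;>
        (try simp only [starRingEnd_apply]) <;> first | linear_combination h | ring
    · rw [Matrix.det_fin_two_of]
      linear_combination h⟩

/-- Differentiating three one-parameter subgroups at the identity gives a basis of `𝔰𝔲(2)`. As `U`
is a complex subspace, these and the scalars yield all of `𝔤𝔩₂`. -/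
theorem collStable_of_forall_tensorRep {U : Submodule ℂ (Qubits n)}
    (hU : ∀ g : SU2, ∀ v ∈ U, tensorRep n g v ∈ U) : CollStable U := by
  have hc : HasDerivAt (fun t : ℝ => Complex.cos t) 0 0 := by
    simpa using (Complex.hasDerivAt_cos (0 : ℝ)).comp_ofReal
  have hs : HasDerivAt (fun t : ℝ => Complex.sin t) 1 0 := by
    simpa using (Complex.hasDerivAt_sin (0 : ℝ)).comp_ofReal
  have sq : ∀ t : ℝ, Complex.cos t * Complex.cos t + Complex.sin t * Complex.sin t = 1 := fun t => by
    linear_combination Complex.cos_sq_add_sin_sq (t : ℂ)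
  have sc : ∀ t : ℝ, star (Complex.cos t) = Complex.cos t := fun t => by
    rw [← starRingEnd_apply, ← Complex.cos_conj, Complex.conj_ofReal]
  have ss : ∀ t : ℝ, star (Complex.sin t) = Complex.sin t := fun t => by
    rw [← starRingEnd_apply, ← Complex.sin_conj, Complex.conj_ofReal]
  have sI : star Complex.I = -Complex.I := Complex.conj_I
  have hZ : ∀ v ∈ U, coll n !![Complex.I, 0; 0, -Complex.I] v ∈ U := by
    refine coll_mem_of_curve hU (fun t => su2Mk (Complex.cos t + Complex.sin t * Complex.I) 0 ?_)
      ?_ ?_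
    · simp only [star_add, star_mul, sc, ss, sI, star_zero]
      linear_combination sq t - Complex.sin t * Complex.sin t * Complex.I_mul_I
    · ext i j; fin_cases i <;> fin_cases j <;> simp [su2Mk]
    · intro i j
      fin_cases i <;> fin_cases j
      · simpa [su2Mk] using hc.fun_add (hs.mul_const Complex.I)
      · simpa [su2Mk] using hasDerivAt_const (0 : ℝ) (0 : ℂ)
      · simpa [su2Mk] using hasDerivAt_const (0 : ℝ) (0 : ℂ)
      · have := hc.fun_add (hs.mul_const (-Complex.I))
        simp only [su2Mk, star_add, star_mul, sc, ss, sI]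
        simpa [mul_comm] using this
  have hY : ∀ v ∈ U, coll n !![0, -1; 1, 0] v ∈ U := by
    refine coll_mem_of_curve hU (fun t => su2Mk (Complex.cos t) (Complex.sin t) ?_) ?_ ?_
    · simp only [sc, ss]
      exact sq t
    · ext i j; fin_cases i <;> fin_cases j <;> simp [su2Mk]
    · intro i j
      simp only [su2Mk, sc, ss]
      fin_cases i <;> fin_cases j
      · simpa using hc
      · simpa using hs.fun_neg
      · simpa using hs
      · simpa using hc
  have hX : ∀ v ∈ U, coll n !![0, Complex.I; Complex.I, 0] v ∈ U := by
    refine coll_mem_of_curve hU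
      (fun t => su2Mk (Complex.cos t) (Complex.sin t * Complex.I) ?_) ?_ ?_
    · simp only [star_mul, sc, ss, sI]
      linear_combination sq t - Complex.sin t * Complex.sin t * Complex.I_mul_I
    · ext i j; fin_cases i <;> fin_cases j <;> simp [su2Mk]
    · intro i j
      simp only [su2Mk, sc, ss, sI, star_mul]
      fin_cases i <;> fin_cases j
      · simpa using hc
      · simpa [mul_comm] using hs.mul_const Complex.I
      · simpa using hs.mul_const Complex.I
      · simpa using hc
  refine .of_generators (fun v hv => ?_) (fun v hv => ?_) (fun v hv => ?_)
  · have h : nMat = (1 / 2 : ℂ) • 1 + (Complex.I / 2) • !![Complex.I, 0; 0, -Complex.I] := by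
      ext i j; fin_cases i <;> fin_cases j <;> simp [nMat] <;> ring_nf <;> norm_num
    rw [h, coll_add, coll_smul, coll_smul, coll_one]
    exact U.add_mem (U.smul_mem _ (U.smul_mem _ hv)) (U.smul_mem _ (hZ v hv))
  · have h : eMat = (-1 / 2 : ℂ) • !![0, -1; 1, 0]
        + (-Complex.I / 2) • !![0, Complex.I; Complex.I, 0] := by
      ext i j; fin_cases i <;> fin_cases j <;> simp [eMat] <;> ring_nf <;> norm_num
    rw [h, coll_add, coll_smul, coll_smul]
    exact U.add_mem (U.smul_mem _ (hY v hv)) (U.smul_mem _ (hX v hv))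
  · have h : fMat = (1 / 2 : ℂ) • !![0, -1; 1, 0]
        + (-Complex.I / 2) • !![0, Complex.I; Complex.I, 0] := by
      ext i j; fin_cases i <;> fin_cases j <;> simp [fMat] <;> ring_nf <;> norm_num
    rw [h, coll_add, coll_smul, coll_smul]
    exact U.add_mem (U.smul_mem _ (hY v hv)) (U.smul_mem _ (hX v hv))

/-- A subspace is `SU(2)`-stable if and only if it is `𝔤𝔩₂`-stable. -/
theorem forall_tensorRep_mem_iff {U : Submodule ℂ (Qubits n)} :
    (∀ g : SU2, ∀ v ∈ U, tensorRep n g v ∈ U) ↔ CollStable U := by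
  refine ⟨collStable_of_forall_tensorRep, fun h g => h.tensorPow_mem ?_⟩
  rw [(Matrix.mem_specialUnitaryGroup_iff.mp g.2).2]
  exact one_ne_zero

/-! ### Weight vectors and weight strings. -/

/-- `N` is diagonal in the basis of strings, with the number of ones as diagonal entry. -/
theorem exists_nat_of_coll_nMat_eigenvector {v : Qubits n} (hv : v ≠ 0) {c : ℂ}
    (h : coll n nMat v = c • v) : ∃ j : ℕ, j ≤ n ∧ c = j := by
  obtain ⟨I, hI⟩ : ∃ I, v I ≠ 0 := by
    by_contra! h0
    exact hv (by ext I; simpa using h0 I)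
  refine ⟨(univ.filter fun i => I i = 1).card, (card_filter_le _ _).trans (by simp), ?_⟩
  have := congrArg (fun w : Qubits n => w I) h
  simp only [coll_nMat_apply, PiLp.smul_apply, smul_eq_mul] at this
  exact (mul_right_cancel₀ hI this).symm

/-- A nonzero stable subspace contains an eigenvector of `coll n nMat` killed by `coll n eMat`. -/
theorem CollStable.exists_weight_vector {U : Submodule ℂ (Qubits n)} (hU : CollStable U)
    (h0 : U ≠ ⊥) :
    ∃ j : ℕ, ∃ v ∈ U, v ≠ 0 ∧ coll n nMat v = (j : ℂ) • v ∧ coll n eMat v = 0 := by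
  have hne : ∃ j : ℕ, ∃ v ∈ U, v ≠ 0 ∧ coll n nMat v = (j : ℂ) • v := by
    have : Nontrivial U := Submodule.nontrivial_iff_ne_bot.mpr h0
    obtain ⟨μ, hμ⟩ := Module.End.exists_eigenvalue ((coll n nMat).restrict (hU nMat))
    obtain ⟨⟨v, hvU⟩, hv⟩ := hμ.exists_hasEigenvector
    have h1 : coll n nMat v = μ • v := congrArg Subtype.val hv.apply_eq_smul
    have h2 : v ≠ 0 := fun h => hv.2 (by simpa using h)
    obtain ⟨j, -, rfl⟩ := exists_nat_of_coll_nMat_eigenvector h2 h1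
    exact ⟨j, v, hvU, h2, h1⟩
  classical
  -- Take the smallest weight in `U`: `E` lowers the weight by one, so it must kill `v`.
  obtain ⟨v, hvU, hv0, hv⟩ := Nat.find_spec hne
  refine ⟨Nat.find hne, v, hvU, hv0, hv, ?_⟩
  by_contra hE
  have h1 : coll n nMat (coll n eMat v) = ((Nat.find hne : ℂ) - 1) • coll n eMat v := by
    rw [coll_n_e, hv, map_smul, sub_smul, one_smul]
  obtain ⟨i, -, hi⟩ := exists_nat_of_coll_nMat_eigenvector hE h1
  have hlt : i < Nat.find hne := by
    have : (Nat.find hne : ℂ) = ((i + 1 : ℕ) : ℂ) := by push_cast; linear_combination hi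
    have := Nat.cast_injective this
    omega
  exact Nat.find_min hne hlt ⟨_, hU _ _ hvU, hE, hi ▸ h1⟩

section WeightString

variable {j : ℕ} {v : Qubits n}

theorem coll_nMat_pow_coll_fMat (hN : coll n nMat v = (j : ℂ) • v) (i : ℕ) :
    coll n nMat ((coll n fMat ^ i) v) = ((j + i : ℕ) : ℂ) • (coll n fMat ^ i) v := by
  induction i with
  | zero => simpa using hN
  | succ i ih =>
    rw [pow_succ', Module.End.mul_apply, coll_n_f, ih, map_smul]
    push_cast
    module

/-- Moving `E` past each `F` costs `n - 2N`; the factor is the sum of `n - 2j - 2s` over `0 ≤ s ≤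
i`. -/
theorem coll_eMat_pow_coll_fMat (hN : coll n nMat v = (j : ℂ) • v) (hE : coll n eMat v = 0)
    (i : ℕ) : coll n eMat ((coll n fMat ^ (i + 1)) v)
      = (((i : ℂ) + 1) * (n - 2 * j - i)) • (coll n fMat ^ i) v := by
  induction i with
  | zero => simp [coll_e_f, hE, hN, sub_smul, mul_smul]
  | succ i ih =>
    rw [pow_succ', Module.End.mul_apply, coll_e_f, ih, map_smul, ← Module.End.mul_apply,
      ← pow_succ', coll_nMat_pow_coll_fMat hN, smul_smul, ← add_smul, ← sub_smul]
    congr 1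
    push_cast
    ring

/-- On the `i`-th vector `N` is `j + i` and `FE` is `i(n - 2j - i + 1)`; the dependence on `i`
cancels. -/
theorem casimir_pow_coll_fMat (hN : coll n nMat v = (j : ℂ) • v) (hE : coll n eMat v = 0)
    (i : ℕ) : casimir n ((coll n fMat ^ i) v)
      = ((j : ℂ) * (n + 1 - j)) • (coll n fMat ^ i) v := by
  cases i with
  | zero =>
    simp only [casimir_apply, pow_zero, Module.End.one_apply, hN, hE, map_zero, sub_zero, map_smul,
      smul_smul, ← sub_smul]
    congr 1
    ring
  | succ i =>
    rw [casimir_apply, coll_eMat_pow_coll_fMat hN hE, map_smul,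
      ← Module.End.mul_apply (coll n fMat), ← pow_succ', coll_nMat_pow_coll_fMat hN, map_smul, coll_nMat_pow_coll_fMat hN, smul_smul,
      smul_smul, ← sub_smul, ← sub_smul]
    congr 1
    push_cast
    ring

/-- The span of the vectors obtained by repeatedly applying `coll n fMat` to a lowest weight
vector: it is stable, has dimension `n - 2 j + 1`, and the Casimir operator is constant on it. -/
theorem exists_collStable_weight_string (hv : v ≠ 0) (hN : coll n nMat v = (j : ℂ) • v)
    (hE : coll n eMat v = 0) :
    2 * j ≤ n ∧ ∃ S : Submodule ℂ (Qubits n), v ∈ S ∧ CollStable S ∧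
      (∀ U, CollStable U → v ∈ U → S ≤ U) ∧ Module.finrank ℂ S = n - 2 * j + 1 ∧
      ∀ w ∈ S, casimir n w = ((j : ℂ) * (n + 1 - j)) • w := by
  have hex : ∃ i, (coll n fMat ^ i) v = 0 := by
    -- A nonzero vector here would have weight `j + n + 1 > n`.
    refine ⟨n + 1, ?_⟩
    by_contra h
    obtain ⟨k, hk, hk'⟩ :=
      exists_nat_of_coll_nMat_eigenvector h (coll_nMat_pow_coll_fMat hN (n + 1))
    have := Nat.cast_injective hk'
    omega
  classical
  obtain ⟨e, he⟩ : ∃ e, Nat.find hex = e + 1 := by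
    refine Nat.exists_eq_succ_of_ne_zero fun h => hv ?_
    simpa [h] using Nat.find_spec hex
  have hzero : (coll n fMat ^ (e + 1)) v = 0 := he ▸ Nat.find_spec hex
  have hne : ∀ i < e + 1, (coll n fMat ^ i) v ≠ 0 := fun i hi => Nat.find_min hex (he ▸ hi)
  -- Applying `E` to `F^(e+1) v = 0` gives `(e+1)(n-2j-e) F^e v = 0`, while `F^e v ≠ 0`.
  have hlen : n = 2 * j + e := by
    have h1 := coll_eMat_pow_coll_fMat hN hE e
    rw [hzero, map_zero, eq_comm, smul_eq_zero_iff_left (hne e e.lt_succ_self)] at h1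
    rcases mul_eq_zero.mp h1 with h | h
    · exact absurd h (Nat.cast_add_one_ne_zero e)
    · have : (n : ℂ) = ((2 * j + e : ℕ) : ℂ) := by push_cast; linear_combination h
      exact Nat.cast_injective this
  have hmem : ∀ i, (coll n fMat ^ i) v
      ∈ Submodule.span ℂ (Set.range fun i : Fin (e + 1) => (coll n fMat ^ (i : ℕ)) v) := by
    intro i
    rcases lt_or_ge i (e + 1) with hi | hi
    · exact Submodule.subset_span ⟨⟨i, hi⟩, rfl⟩
    · obtain ⟨k, rfl⟩ := Nat.exists_eq_add_of_le' hi
      rw [pow_add, Module.End.mul_apply, hzero, map_zero]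
      exact Submodule.zero_mem _
  have hstable : ∀ A : Module.End ℂ (Qubits n),
      (∀ i, A ((coll n fMat ^ i) v)
        ∈ Submodule.span ℂ (Set.range fun i : Fin (e + 1) => (coll n fMat ^ (i : ℕ)) v)) →
      ∀ w ∈ Submodule.span ℂ (Set.range fun i : Fin (e + 1) => (coll n fMat ^ (i : ℕ)) v),
        A w ∈ Submodule.span ℂ (Set.range fun i : Fin (e + 1) => (coll n fMat ^ (i : ℕ)) v) := by
    intro A hA w hw
    exact (Submodule.span_le.mpr (by rintro _ ⟨i, rfl⟩; exact hA i) :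
      _ ≤ Submodule.comap A (Submodule.span ℂ _)) hw
  refine ⟨by omega, Submodule.span ℂ (Set.range fun i : Fin (e + 1) => (coll n fMat ^ (i : ℕ)) v),
    by simpa using hmem 0, .of_generators (hstable _ fun i => ?_) (hstable _ fun i => ?_)
    (hstable _ fun i => ?_), fun U hU hvU => ?_, ?_, fun w hw => ?_⟩
  · rw [coll_nMat_pow_coll_fMat hN]
    exact Submodule.smul_mem _ _ (hmem i)
  · cases i with
    | zero => simp [hE]
    | succ i =>
      rw [coll_eMat_pow_coll_fMat hN hE]
      exact Submodule.smul_mem _ _ (hmem i)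
  · rw [← Module.End.mul_apply, ← pow_succ']
    exact hmem _
  · rw [Submodule.span_le]
    rintro _ ⟨i, rfl⟩
    change (coll n fMat ^ (i : ℕ)) v ∈ U
    generalize (i : ℕ) = k
    induction k with
    | zero => simpa using hvU
    | succ k ih =>
      rw [pow_succ', Module.End.mul_apply]
      exact hU _ _ ih
  · rw [finrank_span_eq_card]
    · simp; omega
    -- The vectors of the string have distinct weights.
    · refine Module.End.eigenvectors_linearIndependent' (coll n nMat)
        (fun i : Fin (e + 1) => ((j + i : ℕ) : ℂ)) (fun a b h => ?_) _ fun i =>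
        ⟨Module.End.mem_eigenspace_iff.mpr (coll_nMat_pow_coll_fMat hN i), hne i i.2⟩
      have := Nat.cast_injective h
      exact Fin.ext (by omega)
  · exact Module.End.mem_eigenspace_iff.mp ((Submodule.span_le.mpr (by
      rintro _ ⟨i, rfl⟩
      exact Module.End.mem_eigenspace_iff.mpr (casimir_pow_coll_fMat hN hE i)) :
      _ ≤ (casimir n).eigenspace ((j : ℂ) * (n + 1 - j))) hw)

end WeightString

/-! ### Irreducible subrepresentations and the isotypical decomposition. -/

/-- The subrepresentation of `(ℂ²)^{⊗ n}` on a stable subspace. -/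
def CollStable.subrep {U : Submodule ℂ (Qubits n)} (hU : CollStable U) :
    Subrepresentation (tensorRep n) :=
  ⟨U, fun g _ hv => forall_tensorRep_mem_iff.mpr hU g _ hv⟩

theorem collStable_toSubmodule (W : Subrepresentation (tensorRep n)) : CollStable W.toSubmodule :=
  forall_tensorRep_mem_iff.mp fun g _ hv => W.apply_mem_toSubmodule g hv

/-- A subrepresentation is irreducible if and only if it is a minimal nonzero stable subspace. -/
theorem isIrreducible_iff (W : Subrepresentation (tensorRep n)) :
    W.toRepresentation.IsIrreducible ↔ W.toSubmodule ≠ ⊥ ∧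
      ∀ U, CollStable U → U ≤ W.toSubmodule → U ≠ ⊥ → U = W.toSubmodule := by
  constructor
  · intro h
    refine ⟨fun h0 => ?_, fun U hU hUW h0 => ?_⟩
    · have hbt : (⊥ : Subrepresentation W.toRepresentation) = ⊤ := by
        refine Subrepresentation.toSubmodule_injective ?_
        have : Subsingleton W.toSubmodule := by rw [h0]; infer_instance
        exact Subsingleton.elim _ _
      exact bot_ne_top hbt
    · let V : Subrepresentation W.toRepresentation :=
        ⟨U.comap W.toSubmodule.subtype, fun g x hx => hU.subrep.apply_mem_toSubmodule g hx⟩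
      rcases eq_bot_or_eq_top V with hV | hV
      · have h1 : U.comap W.toSubmodule.subtype = ⊥ :=
          congrArg Subrepresentation.toSubmodule hV
        have h2 := Submodule.map_comap_subtype W.toSubmodule U
        rw [h1, Submodule.map_bot, inf_eq_right.mpr hUW] at h2
        exact absurd h2.symm h0
      · have h1 : U.comap W.toSubmodule.subtype = ⊤ :=
          congrArg Subrepresentation.toSubmodule hV
        exact le_antisymm hUW (Submodule.comap_subtype_eq_top.mp h1)
  · rintro ⟨h0, hmin⟩
    refine { exists_pair_ne := ⟨⊥, ⊤, fun h => h0 ?_⟩, eq_bot_or_eq_top := fun V => ?_ }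
    · have h1 : (⊥ : Submodule ℂ W.toSubmodule) = ⊤ := congrArg Subrepresentation.toSubmodule h
      rw [← Submodule.map_subtype_top W.toSubmodule, ← h1, Submodule.map_bot]
    · have hst : CollStable (V.toSubmodule.map W.toSubmodule.subtype) := by
        refine forall_tensorRep_mem_iff.mp fun g v hv => ?_
        obtain ⟨w, hw, rfl⟩ := hv
        exact ⟨_, V.apply_mem_toSubmodule g hw, rfl⟩
      by_cases hb : V.toSubmodule = ⊥
      · exact Or.inl (Subrepresentation.toSubmodule_injective hb)
      · refine Or.inr (Subrepresentation.toSubmodule_injective ?_)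
        have h1 := hmin _ hst (Submodule.map_subtype_le _ _) fun h => hb
          (Submodule.map_injective_of_injective W.toSubmodule.subtype_injective (by
            rw [h, Submodule.map_bot]))
        change V.toSubmodule = ⊤
        refine Submodule.map_injective_of_injective W.toSubmodule.subtype_injective ?_
        rw [h1, Submodule.map_subtype_top]

/-- By minimality `W` equals the string generated by any weight vector in it that `E` kills. -/
theorem casimir_of_isIrreducible {W : Subrepresentation (tensorRep n)}
    (h : W.toRepresentation.IsIrreducible) :
    ∃ j : ℕ, 2 * j ≤ n ∧ Module.finrank ℂ W.toSubmodule = n - 2 * j + 1 ∧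
      ∀ w ∈ W.toSubmodule, casimir n w = ((j : ℂ) * (n + 1 - j)) • w := by
  rw [isIrreducible_iff] at h
  obtain ⟨j, v, hvW, hv0, hN, hE⟩ := (collStable_toSubmodule W).exists_weight_vector h.1
  obtain ⟨hj, S, hvS, hS, hmin, hdim, hcas⟩ := exists_collStable_weight_string hv0 hN hE
  have := h.2 S hS (hmin _ (collStable_toSubmodule W) hvW) fun h0 => hv0 (by simpa [h0] using hvS)
  exact ⟨j, hj, this ▸ hdim, this ▸ hcas⟩

theorem isotypic_le_eigenspace {x : ℕ} (hx : 2 * x ≤ n) :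
    isotypic n x ≤ (casimir n).eigenspace ((x : ℂ) * (n + 1 - x)) := by
  refine iSup₂_le fun W hW => ?_
  obtain ⟨j, hj, hdim, hcas⟩ := casimir_of_isIrreducible hW.1
  obtain rfl : j = x := by have := hW.2; omega
  exact fun w hw => Module.End.mem_eigenspace_iff.mpr (hcas w hw)

theorem CollStable.exists_irreducible_le {U : Submodule ℂ (Qubits n)} (hU : CollStable U)
    (h0 : U ≠ ⊥) : ∃ W : Subrepresentation (tensorRep n),
      W.toRepresentation.IsIrreducible ∧ W.toSubmodule ≤ U := by
  induction hd : Module.finrank ℂ U using Nat.strong_induction_on generalizing U with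
  | _ d ih =>
    by_cases hmin : ∀ V, CollStable V → V ≤ U → V ≠ ⊥ → V = U
    · exact ⟨hU.subrep, (isIrreducible_iff _).mpr ⟨h0, hmin⟩, le_rfl⟩
    · push Not at hmin
      obtain ⟨V, hV, hVU, hV0, hne⟩ := hmin
      obtain ⟨W, hW, hWV⟩ := ih _ (hd ▸ Submodule.finrank_lt_finrank_of_lt (hVU.lt_of_ne hne))
        hV hV0 rfl
      exact ⟨W, hW, hWV.trans hVU⟩

theorem CollStable.iSup {ι : Sort*} {U : ι → Submodule ℂ (Qubits n)}
    (hU : ∀ i, CollStable (U i)) : CollStable (⨆ i, U i) := by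
  intro A v hv
  exact (iSup_le fun i w hw => le_iSup U i (hU i A w hw) :
    ⨆ i, U i ≤ (⨆ i, U i).comap (coll n A)) hv

/-- Otherwise the orthogonal complement of the sum, being stable, contains an irreducible subspace;
but that subspace lies in one of the summands. -/
theorem iSup_isotypic : ⨆ x ∈ range (n / 2 + 1), isotypic n x = ⊤ := by
  have hst : CollStable (⨆ x ∈ range (n / 2 + 1), isotypic n x) :=
    .iSup fun x => .iSup fun _ => .iSup fun W => .iSup fun _ => collStable_toSubmodule W
  rw [← Submodule.orthogonal_eq_bot_iff]
  by_contra h0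
  obtain ⟨W, hW, hle⟩ := hst.orthogonal.exists_irreducible_le h0
  obtain ⟨j, hj, hdim, -⟩ := casimir_of_isIrreducible hW
  have h1 : W.toSubmodule ≤ isotypic n j := le_iSup₂_of_le W ⟨hW, hdim⟩ le_rfl
  have h2 : isotypic n j ≤ ⨆ x ∈ range (n / 2 + 1), isotypic n x :=
    le_iSup₂_of_le (f := fun x (_ : x ∈ range (n / 2 + 1)) => isotypic n x) j
      (mem_range.mpr (by omega)) le_rfl
  exact ((isIrreducible_iff W).mp hW).1
    (le_bot_iff.mp (Submodule.orthogonal_disjoint _ (h1.trans h2) hle))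

/-- Isotypical components decompose `(ℂ²)^{⊗ n}`, and the Casimir operator separates them. -/
theorem exists_isotypic_decomposition (ψ : Qubits n) :
    ∃ φ : ℕ → Qubits n, ∑ x ∈ range (n / 2 + 1), φ x = ψ ∧
      ∀ x ∈ range (n / 2 + 1), φ x = (isotypic n x).starProjection ψ ∧
        casimir n (φ x) = ((x : ℂ) * (n + 1 - x)) • φ x := by
  have hψ : ψ ∈ ⨆ x ∈ range (n / 2 + 1), isotypic n x := iSup_isotypic ▸ Submodule.mem_top
  obtain ⟨φ, hφ⟩ := (Submodule.mem_iSup_finset_iff_exists_sum _ _).mp hψ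
  have hle : ∀ x ∈ range (n / 2 + 1), 2 * x ≤ n := fun x hx => by
    have := mem_range.mp hx
    omega
  refine ⟨fun x => φ x, hφ, fun x hx => ⟨?_, ?_⟩⟩
  -- The other summands of `ψ` lie in eigenspaces of the symmetric Casimir operator for other
  -- scalars, so they are orthogonal to this component.
  · refine (Submodule.eq_starProjection_of_mem_orthogonal (φ x).2 ?_).symm
    rw [← hφ, ← add_sum_erase _ _ hx, add_sub_cancel_left]
    refine Submodule.sum_mem _ fun y hy => ?_
    rw [mem_erase] at hy
    intro w hw
    refine casimir_isSymmetric.orthogonalFamily_eigenspaces (i := (x : ℂ) * (n + 1 - x))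
      (j := (y : ℂ) * (n + 1 - y)) ?_ ⟨w, isotypic_le_eigenspace (hle x hx) hw⟩
      ⟨φ y, isotypic_le_eigenspace (hle y hy.2) (φ y).2⟩
    intro h
    -- Equal scalars give `(x - y)(n + 1 - x - y) = 0`, and the second factor is positive since `2x,
    -- 2y ≤ n`.
    have h1 : ((x : ℂ) - y) * (((n + 1 - (x + y) : ℤ)) : ℂ) = 0 := by
      push_cast
      linear_combination h
    have h2 := hle x hx
    have h3 := hle y hy.2
    rcases mul_eq_zero.mp h1 with h | h
    · exact hy.1 (Nat.cast_injective (sub_eq_zero.mp h)).symm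
    · have := Int.cast_eq_zero.mp h
      omega
  · exact Module.End.mem_eigenspace_iff.mp (isotypic_le_eigenspace (hle x hx) (φ x).2)

/-! ### Coordinates of `Ξ` and its Casimir expectation. -/

theorem coll_eMat_apply (v : Qubits n) (I : Fin n → Fin 2) :
    coll n eMat v I = ∑ s, if I s = 0 then v (Function.update I s 1) else 0 := by
  rw [coll_apply]
  refine sum_congr rfl fun r _ => ?_
  obtain h | h : I r = 0 ∨ I r = 1 := by lia
  · simp [eMat, h]
  · simp [eMat, h]

theorem coll_fMat_apply (v : Qubits n) (I : Fin n → Fin 2) :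
    coll n fMat v I = ∑ r, if I r = 1 then v (Function.update I r 0) else 0 := by
  rw [coll_apply]
  refine sum_congr rfl fun r _ => ?_
  obtain h | h : I r = 0 ∨ I r = 1 := by lia
  · simp [fMat, h]
  · simp [fMat, h]

/-- The strings `1^l 0^{k-l} J` with `J` having exactly `d` ones. -/
def IsXiString (k l d : ℕ) (I : Fin n → Fin 2) : Prop :=
  (∀ i : Fin n, (i : ℕ) < k → I i = if (i : ℕ) < l then 1 else 0) ∧
    (univ.filter fun i : Fin n => k ≤ i ∧ I i = 1).card = d

theorem dicke_apply (a d : ℕ) (J : Fin a → Fin 2) :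
    dicke a d J = if (univ.filter fun i => J i = 1).card = d
      then (((Real.sqrt (a.choose d : ℝ))⁻¹ : ℝ) : ℂ) else 0 := by
  simp [dicke, ket, mem_filter]

theorem card_ones_suffix {k : ℕ} (hk : k ≤ n) (I : Fin n → Fin 2) :
    (univ.filter fun j : Fin (n - k) =>
      I (Fin.cast (Nat.add_sub_of_le hk) (Fin.natAdd k j)) = 1).card
      = (univ.filter fun i : Fin n => k ≤ i ∧ I i = 1).card := by
  refine card_bij (fun j _ => Fin.cast (Nat.add_sub_of_le hk) (Fin.natAdd k j)) ?_ ?_ ?_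
  · intro j hj
    simpa using hj
  · intro a _ b _ h
    simpa [Fin.ext_iff] using h
  · intro i hi
    obtain ⟨h1, h2⟩ := (mem_filter.mp hi).2
    have h3 : Fin.cast (Nat.add_sub_of_le hk) (Fin.natAdd k ⟨i - k, by omega⟩) = i :=
      Fin.ext (by simp; omega)
    exact ⟨⟨i - k, by omega⟩, mem_filter.mpr ⟨mem_univ _, by rw [h3]; exact h2⟩, h3⟩

open Classical in
theorem xi_apply (m k l : ℕ) (hk : k ≤ n) (I : Fin n → Fin 2) :
    xi n m k l hk I = if IsXiString k l (m - l) I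
      then (((Real.sqrt ((n - k).choose (m - l) : ℝ))⁻¹ : ℝ) : ℂ) else 0 := by
  have h1 : ((fun i : Fin k => I (Fin.cast (Nat.add_sub_of_le hk) (Fin.castAdd (n - k) i)))
      = fun i : Fin k => if (i : ℕ) < l then 1 else 0)
      ↔ ∀ i : Fin n, (i : ℕ) < k → I i = if (i : ℕ) < l then 1 else 0 := by
    rw [funext_iff]
    exact ⟨fun h i hi => h ⟨i, hi⟩, fun h i => h _ i.2⟩
  change onesZeros k l _ * dicke (n - k) (m - l) _ = _
  rw [dicke_apply, card_ones_suffix hk, onesZeros, ket, PiLp.single_apply, IsXiString,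
    ← h1]
  split_ifs <;> simp_all

theorem card_filter_le_val {k : ℕ} (hk : k ≤ n) :
    (univ.filter fun i : Fin n => k ≤ (i : ℕ)).card = n - k := by
  have := card_ones_suffix hk fun _ => 1
  simpa using this.symm

-- An admissible string is determined by the set of ones among its last `n - k` places.
open Classical in
theorem card_isXiString {k : ℕ} (hk : k ≤ n) (l d : ℕ) :
    (univ.filter fun I : Fin n → Fin 2 => IsXiString k l d I).card = (n - k).choose d := by
  rw [← card_filter_le_val hk, ← card_powersetCard]
  refine card_nbij' (fun I => univ.filter fun i : Fin n => k ≤ i ∧ I i = 1)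
    (fun T i => if (i : ℕ) < k then (if (i : ℕ) < l then 1 else 0) else if i ∈ T then 1 else 0)
    ?_ ?_ ?_ ?_
  · intro I hI
    have hI' : IsXiString k l d I := by simpa using hI
    rw [mem_coe, mem_powersetCard]
    exact ⟨fun i hi => by simp_all, hI'.2⟩
  · intro T hT
    rw [mem_coe, mem_powersetCard] at hT
    rw [mem_coe, mem_filter]
    refine ⟨mem_univ _, fun i hi => by simp [hi], ?_⟩
    rw [← hT.2]
    congr 1
    ext i
    have : i ∈ T → k ≤ (i : ℕ) := fun hi => (mem_filter.mp (hT.1 hi)).2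
    by_cases h : i ∈ T
    · simp [h, this h, not_lt.mpr (this h)]
    · by_cases hik : (i : ℕ) < k
      · simp [h, not_le.mpr hik]
      · simp [h, hik]
  · intro I hI
    have hI' : IsXiString k l d I := by simpa using hI
    funext i
    by_cases h : (i : ℕ) < k
    · simp [h, hI'.1 i h]
    · obtain h1 | h1 : I i = 0 ∨ I i = 1 := by lia
      · simp [h, h1]
      · simp [h, h1, not_lt.mp h]
  · intro T hT
    rw [mem_coe, mem_powersetCard] at hT
    ext i
    have : i ∈ T → k ≤ (i : ℕ) := fun hi => (mem_filter.mp (hT.1 hi)).2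
    by_cases h : i ∈ T
    · simp [h, this h, not_lt.mpr (this h)]
    · by_cases hik : (i : ℕ) < k
      · simp [h, not_le.mpr hik]
      · simp [h, hik]

theorem inner_xi_self {m k l : ℕ} (hk : k ≤ n) (h : m - l ≤ n - k) :
    inner ℂ (xi n m k l hk) (xi n m k l hk) = 1 := by
  classical
  have hpos : (0 : ℝ) < (n - k).choose (m - l) := by exact_mod_cast Nat.choose_pos h
  simp only [PiLp.inner_apply, RCLike.inner_apply, xi_apply]
  simp only [apply_ite (starRingEnd ℂ), Complex.conj_ofReal, map_zero, ← ite_and, mul_ite, ite_mul,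
    zero_mul, mul_zero, and_self]
  rw [← sum_filter, sum_const, card_isXiString hk, nsmul_eq_mul]
  rw [← Complex.ofReal_mul, ← mul_inv, Real.mul_self_sqrt hpos.le]
  push_cast
  exact mul_inv_cancel₀ (by exact_mod_cast hpos.ne')

namespace IsXiString

variable {k l d : ℕ} {I : Fin n → Fin 2}

theorem card_ones (h : IsXiString k l d I) (hk : k ≤ n) (hl : l ≤ k) :
    (univ.filter fun i => I i = 1).card = l + d := by
  rw [← card_filter_add_card_filter_not (s := univ.filter fun i => I i = 1)
    (fun i : Fin n => (i : ℕ) < k), filter_filter, filter_filter, ← h.2]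
  congr 1
  · have h1 : (univ.filter fun i : Fin n => I i = 1 ∧ (i : ℕ) < k)
        = univ.filter fun i : Fin n => (i : ℕ) < l := by
      ext i
      simp only [mem_filter, mem_univ, true_and]
      refine ⟨fun ⟨h2, h3⟩ => ?_, fun h2 => ⟨?_, by omega⟩⟩
      · by_contra h4
        simp [h.1 i h3, h4] at h2
      · simp [h.1 i (by omega), h2]
    rw [h1, Fin.card_filter_val_lt, min_eq_right (by omega)]
  · congr 1
    ext i
    simp [and_comm]

theorem card_zeros_suffix (h : IsXiString k l d I) (hk : k ≤ n) :
    (univ.filter fun i : Fin n => k ≤ i ∧ I i = 0).card + d = n - k := by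
  rw [← card_filter_le_val hk, ← h.2, ← card_filter_add_card_filter_not
    (s := univ.filter fun i : Fin n => k ≤ (i : ℕ)) (fun i : Fin n => I i = 0), filter_filter,
    filter_filter]
  congr 2
  ext i
  have : I i = 1 ↔ ¬ I i = 0 := by lia
  simp [this]

/-- Moving a one of an admissible string gives an admissible string exactly when it happens in the
last `n - k` places. -/
theorem move_iff (h : IsXiString k l d I) {r s : Fin n} (hr : I r = 1) (hs : I s = 0) :
    IsXiString k l d (Function.update (Function.update I r 0) s 1) ↔
      k ≤ (r : ℕ) ∧ k ≤ (s : ℕ) := by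
  have hrs : r ≠ s := fun e => by simp [e, hs] at hr
  constructor
  · intro h'
    constructor
    · by_contra! hlt
      have h1 := h'.1 r hlt
      rw [Function.update_of_ne hrs, Function.update_self, ← h.1 r hlt, hr] at h1
      exact absurd h1 (by decide)
    · by_contra! hlt
      have h1 := h'.1 s hlt
      rw [Function.update_self, ← h.1 s hlt, hs] at h1
      exact absurd h1 (by decide)
  · rintro ⟨hkr, hks⟩
    refine ⟨fun i hi => ?_, ?_⟩
    · rw [Function.update_of_ne (fun e => by subst e; omega),
        Function.update_of_ne (fun e => by subst e; omega), h.1 i hi]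
    · have h1 : (univ.filter fun i : Fin n => k ≤ (i : ℕ) ∧
          Function.update (Function.update I r 0) s 1 i = 1)
          = insert s ((univ.filter fun i : Fin n => k ≤ (i : ℕ) ∧ I i = 1).erase r) := by
        ext i
        by_cases his : i = s
        · simp [his, hks]
        · by_cases hir : i = r
          · simp [hir, hrs]
          · simp [his, hir]
      have h2 : r ∈ univ.filter fun i : Fin n => k ≤ (i : ℕ) ∧ I i = 1 := by simp [hkr, hr]
      rw [h1, card_insert_of_notMem (by simp [hs]), card_erase_add_one h2, h.2]

end IsXiString

theorem coll_nMat_xi {m k l : ℕ} (hk : k ≤ n) (hlk : l ≤ k) (hlm : l ≤ m) :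
    coll n nMat (xi n m k l hk) = (m : ℂ) • xi n m k l hk := by
  classical
  ext I
  rw [coll_nMat_apply, PiLp.smul_apply, smul_eq_mul, xi_apply]
  split_ifs with h
  · rw [h.card_ones hk hlk, Nat.add_sub_of_le hlm]
  · simp

/-- The coordinate sums `Ξ` over all ways to erase a one of `I` at `r` and then write a one at a
zero `s`. The choice `s = r` restores `I` and contributes `m`. For `s ≠ r` the result is admissible
only if both places lie in the last `n - k`, which leaves `m - l` choices of `r` and `n - m - k + l`
of `s`. -/
theorem coll_fMat_coll_eMat_xi_apply {m k l : ℕ} (hk : k ≤ n) (hlk : l ≤ k) (hlm : l ≤ m)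
    {I : Fin n → Fin 2} (hI : IsXiString k l (m - l) I) :
    coll n fMat (coll n eMat (xi n m k l hk)) I
      = ((m : ℂ) + (m - l) * (n - m - k + l)) * xi n m k l hk I := by
  classical
  have hm := hI.card_ones hk hlk
  have hz := hI.card_zeros_suffix hk
  have hd := hI.2
  set z := (univ.filter fun i : Fin n => k ≤ (i : ℕ) ∧ I i = 0).card with hzdef
  set c := xi n m k l hk I with hc
  have hxi : ∀ J, xi n m k l hk J = if IsXiString k l (m - l) J then c else 0 := fun J => by
    rw [hc, xi_apply, xi_apply, if_pos hI]
  have key : ∀ r, I r = 1 → coll n eMat (xi n m k l hk) (Function.update I r 0)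
      = (1 + if k ≤ (r : ℕ) then (z : ℂ) else 0) * c := by
    intro r hr
    have hback : Function.update (Function.update I r 0) r 1 = I := by
      rw [Function.update_idem, ← hr, Function.update_eq_self]
    rw [coll_eMat_apply, ← add_sum_erase _ _ (mem_univ r), Function.update_self, if_pos rfl, hback,
      add_mul, one_mul]
    congr 1
    have h1 : ∀ s ∈ univ.erase r, (if Function.update I r 0 s = 0
        then xi n m k l hk (Function.update (Function.update I r 0) s 1) else 0)
        = if k ≤ (r : ℕ) ∧ k ≤ (s : ℕ) ∧ I s = 0 then c else 0 := by
      intro s hs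
      rw [Function.update_of_ne (ne_of_mem_erase hs)]
      by_cases h0 : I s = 0
      · rw [if_pos h0, hxi]
        simp only [hI.move_iff hr h0, h0, and_true]
      · simp [h0]
    -- The index `r` may be put back, because `I r = 1` makes its term zero.
    rw [sum_congr rfl h1, sum_erase _ (by simp [hr])]
    by_cases hkr : k ≤ (r : ℕ)
    · simp only [hkr, true_and, if_true]
      rw [← sum_filter, sum_const, nsmul_eq_mul]
    · simp [hkr]
  rw [coll_fMat_apply, ← sum_filter, sum_congr rfl fun r hr => key r (mem_filter.mp hr).2,
    ← sum_mul, sum_add_distrib, sum_const, ← sum_filter, sum_const, filter_filter, hm]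
  have hd' : (univ.filter fun i : Fin n => I i = 1 ∧ k ≤ (i : ℕ)).card = m - l := by
    rw [← hd]; congr 1; ext i; simp [and_comm]
  have hzc : (z : ℂ) = n - m - k + l := by
    have : z + m + k = n + l := by omega
    have : (z : ℂ) + m + k = n + l := by exact_mod_cast this
    linear_combination this
  rw [hd', hzc, nsmul_eq_mul, nsmul_eq_mul, Nat.add_sub_of_le hlm, Nat.cast_sub hlm]
  ring

theorem inner_xi_casimir_xi {m k l : ℕ} (hk : k ≤ n) (hlk : l ≤ k) (hlm : l ≤ m)
    (h : m - l ≤ n - k) : inner ℂ (xi n m k l hk) (casimir n (xi n m k l hk))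
      = (m : ℂ) * (n - m) - (m - l) * (n - m - k + l) := by
  have h1 : inner ℂ (xi n m k l hk) (coll n fMat (coll n eMat (xi n m k l hk)))
      = ((m : ℂ) + (m - l) * (n - m - k + l)) := by
    rw [← mul_one ((m : ℂ) + _), ← inner_xi_self (m := m) (l := l) hk h, ← inner_smul_right]
    simp only [PiLp.inner_apply, RCLike.inner_apply, PiLp.smul_apply, smul_eq_mul]
    refine sum_congr rfl fun I _ => ?_
    -- `FE Ξ` may be nonzero at inadmissible strings, but there `Ξ` itself vanishes.
    by_cases hI : IsXiString k l (m - l) I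
    · rw [coll_fMat_coll_eMat_xi_apply hk hlk hlm hI]
    · classical
      have : xi n m k l hk I = 0 := by rw [xi_apply, if_neg hI]
      simp [this]
  rw [casimir_apply, inner_sub_right, inner_sub_right, h1, coll_nMat_xi hk hlk hlm, map_smul,
    coll_nMat_xi hk hlk hlm, inner_smul_right, inner_smul_right, inner_smul_right, inner_smul_right,
    inner_xi_self hk h]
  ring

/-! ### The distribution and its moments. -/

theorem pmf_nonneg (m k l : ℕ) (hk : k ≤ n) (x : ℕ) : 0 ≤ pmf n m k l hk x := by
  rw [pmf, ← Submodule.inner_starProjection_left_eq_right]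
  exact (isotypic n x).re_inner_starProjection_nonneg (xi n m k l hk)

/-- The weights `p(x)` sum to one, and the mean of `x (n + 1 - x)` is the expectation of the Casimir
operator. -/
theorem sum_pmf_and_sum_pmf_mul {m k l : ℕ} (hk : k ≤ n) (hlk : l ≤ k) (hlm : l ≤ m)
    (h : m - l ≤ n - k) :
    ∑ x ∈ range (n / 2 + 1), pmf n m k l hk x = 1 ∧
      ∑ x ∈ range (n / 2 + 1), pmf n m k l hk x * (x * (n + 1 - x))
        = (m : ℝ) * (n - m) - (m - l) * (n - m - k + l) := by
  obtain ⟨φ, hsum, hφ⟩ := exists_isotypic_decomposition (xi n m k l hk)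
  have hp : ∀ x ∈ range (n / 2 + 1), pmf n m k l hk x = (inner ℂ (xi n m k l hk) (φ x)).re :=
    fun x hx => by rw [pmf, (hφ x hx).1]
  constructor
  · rw [sum_congr rfl hp, ← Complex.re_sum, ← inner_sum, hsum, inner_xi_self hk h, Complex.one_re]
  · have h1 : ∀ x ∈ range (n / 2 + 1), pmf n m k l hk x * (x * (n + 1 - x))
        = (inner ℂ (xi n m k l hk) (casimir n (φ x))).re := by
      intro x hx
      rw [hp x hx, (hφ x hx).2, inner_smul_right,
        show (x : ℂ) * (n + 1 - x) = (((x : ℝ) * (n + 1 - x) : ℝ) : ℂ) by push_cast; ring,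
        Complex.re_ofReal_mul, mul_comm]
    rw [sum_congr rfl h1, ← Complex.re_sum, ← inner_sum, ← map_sum, hsum,
      inner_xi_casimir_xi hk hlk hlm h,
      show (m : ℂ) * (n - m) - (m - l) * (n - m - k + l)
        = (((m : ℝ) * (n - m) - (m - l) * (n - m - k + l) : ℝ) : ℂ) by push_cast; ring,
      Complex.ofReal_re]

theorem integral_law (m k l : ℕ) (hk : k ≤ n) (f : ℕ → ℝ) :
    ∫ x, f x ∂(law n m k l hk) = ∑ x ∈ range (n / 2 + 1), pmf n m k l hk x * f x := by
  rw [law, integral_finsetSum_measure]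
  · refine sum_congr rfl fun x _ => ?_
    rw [integral_smul_measure, integral_dirac, ENNReal.toReal_ofReal (pmf_nonneg m k l hk x),
      smul_eq_mul]
  · exact fun x _ => (integrable_dirac (by simp)).smul_measure ENNReal.ofReal_ne_top

end SchurWeyl

end

theorem theorem4p13 (n m k l : ℕ) (hn : 0 < n) (hm : m ≤ n) (hk : k ≤ n)
    (hlm : l ≤ m) (hlk : l ≤ k) (hmk : m + k ≤ n + l) :
    ((∀ x ∈ Finset.range (n / 2 + 1), 0 ≤ SchurWeyl.pmf n m k l hk x) ∧
      ∑ x ∈ Finset.range (n / 2 + 1), SchurWeyl.pmf n m k l hk x = 1) ∧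
    ∀ {Ω : Type*} [MeasurableSpace Ω] (μ : MeasureTheory.Measure Ω) (X : Ω → ℕ),
      ProbabilityTheory.HasLaw X (SchurWeyl.law n m k l hk) μ →
        ProbabilityTheory.variance (fun ω => (X ω : ℝ)) μ / (n : ℝ) ^ 2 =
          (∫ ω, (X ω : ℝ) ∂μ) / n * (1 - (∫ ω, (X ω : ℝ) ∂μ) / n)
            + (∫ ω, (X ω : ℝ) ∂μ) / (n : ℝ) ^ 2 - SchurWeyl.eta n m k l := by
  obtain ⟨h1, h2⟩ := SchurWeyl.sum_pmf_and_sum_pmf_mul (m := m) hk hlk hlm (by omega)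
  refine ⟨⟨fun x _ => SchurWeyl.pmf_nonneg m k l hk x, h1⟩, fun {Ω} _ μ X hX => ?_⟩
  have hint : ∀ f : ℕ → ℝ, ∫ ω, f (X ω) ∂μ
      = ∑ x ∈ Finset.range (n / 2 + 1), SchurWeyl.pmf n m k l hk x * f x := fun f => by
    rw [← SchurWeyl.integral_law, ← hX.integral_comp (by fun_prop)]
    rfl
  have hXr : AEMeasurable (fun ω => (X ω : ℝ)) μ :=
    (measurable_from_nat (f := fun x : ℕ => (x : ℝ))).comp_aemeasurable hX.aemeasurable
  rw [ProbabilityTheory.variance_eq_integral hXr, hint fun x => (x - ∫ ω, (X ω : ℝ) ∂μ) ^ 2]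
  set E := ∫ ω, (X ω : ℝ) ∂μ with hE
  have h3 : E = ∑ x ∈ Finset.range (n / 2 + 1), SchurWeyl.pmf n m k l hk x * x :=
    hint fun x => (x : ℝ)
  -- Weighted sum of `(x - E)² = (n + 1 - 2E)x - x(n + 1 - x) + E²`: the terms have means `(n + 1 -
  -- 2E)E`, the Casimir expectation and `E²`.
  have h4 : ∑ x ∈ Finset.range (n / 2 + 1), SchurWeyl.pmf n m k l hk x * (x - E) ^ 2
      = (n + 1 - 2 * E) * E - ((m : ℝ) * (n - m) - (m - l) * (n - m - k + l)) + E ^ 2 := by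
    rw [← h2]
    -- Only the lone factor `E` becomes a sum; the other occurrences stay as constants.
    nth_rewrite 3 [h3]
    rw [← mul_one (E ^ 2), ← h1, Finset.mul_sum, Finset.mul_sum, ← Finset.sum_sub_distrib,
      ← Finset.sum_add_distrib]
    exact Finset.sum_congr rfl fun x _ => by ring
  have hn' : (n : ℝ) ≠ 0 := by positivity
  rw [h4, SchurWeyl.eta]
  field_simp
  ring
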